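/- Let $D\ge 0$ be an integer and $C>0$. For an even integer $k\ge 0$, $k\neq 2$, write $k=12\ell+k'$ with $\ell\ge 0$ and $k'\in\{0,4,6,8,10,14\}$. Let $\Delta=q\prod_{n\ge1}(1-q^n)^{24}$, let $E_k$ be the normalised Eisenstein series of weight $k$ for $\mathrm{SL}_2(\mathbb Z)$ (with $E_0=1$), $j=E_4^3/\Delta$, and $\mathrm{Ex}_D(t)=\sum_{s=0}^D t^s/s!$. There is a constant $K>0$, depending only on $D$ and $C$, such that the following holds for every such $k$ and every cusp form $f$ of weight $k$ for $\mathrm{SL}_2(\mathbb Z)$ with $\ell\ge D$ and $q$-expansion $$f=q^{\ell-D}\bigl(1+a(1)q+\dots+a(D)q^D\bigr)+O(q^{\ell+1}),\qquad |a(i)|\le C\quad(1\le i\le D).$$ There is a unique polynomial $F_f\in\mathbb C[t]$ (the Faber polynomial of $f$) with $f=\Delta^\ell E_{k'}\,F_f(j)$; it has degree $D$; and $$\frac1{(2k)^D}F_f(2kt)=t^D\,\mathrm{Ex}_D\!\left(\frac1t\right)\left(1+O\!\left(\frac1k\right)\right)$$ coefficient by coefficient, that is, there are $\varepsilon_0,\dots,\varepsilon_D\in\mathbb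 C$ with $|\varepsilon_s|\le K/k$ such that for all complex $t\ne0$ $$\frac1{(2k)^D}F_f(2kt)=t^D\sum_{s=0}^D\frac{(1/t)^s}{s!}\,(1+\varepsilon_s).$$ In particular, for all complex $t\neq 0$, $$\left|\frac1{(2k)^D}F_f(2kt)-t^D\,\mathrm{Ex}_D\!\left(\frac1t\right)\right|\le\frac Kk\,|t|^D\,\mathrm{Ex}_D\!\left(\frac1{|t|}\right).$$ -/

import Mathlib

open Polynomial
open UpperHalfPlane
open scoped MatrixGroups

noncomputable section

/-- The normalised Eisenstein series `E_k = 1/2 ∑_{gcd(c,d)=1} (cτ+d)^{-k}` of level one as a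
function on the upper half-plane, with the convention `E_0 = 1`. (Only the even weights
`k = 0, 4, 6, 8, 10, 14` are used.) -/
def eisenstein (k : ℕ) : ℍ → ℂ :=
  if hk : 3 ≤ k then ⇑(ModularForm.E hk) else 1

/-- Klein's absolute invariant `j = E_4 ^ 3 / Δ` (recall that `Δ` has no zeros on `ℍ`). -/
def kleinJ (τ : ℍ) : ℂ :=
  ModularForm.E₄ τ ^ 3 / ModularForm.discriminant τ

/-- `F` is a Faber polynomial of the function `f` of weight `12 ℓ + k'`:
`f / (Δ ^ ℓ * E_{k'}) = F(j)`, written without denominators so that it is also meaningful at the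
zeros of `E_{k'}`. -/
def IsFaberPolynomial (ℓ k' : ℕ) (f : ℍ → ℂ) (F : ℂ[X]) : Prop :=
  ∀ τ : ℍ, f τ = ModularForm.discriminant τ ^ ℓ * eisenstein k' τ * F.eval (kleinJ τ)

/-- The `q`-expansion of `f` has the shape
`f = q^{ℓ-D} (1 + a(1) q + ⋯ + a(D) q^D) + O(q^{ℓ+1})` with `|a(j)| ≤ C` for `1 ≤ j ≤ D`. -/
def HasLeadingTerms (D : ℕ) (C : ℝ) (ℓ : ℕ) (f : ℍ → ℂ) : Prop :=
  D ≤ ℓ ∧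
  (∀ n < ℓ - D, (qExpansion 1 f).coeff n = 0) ∧
  (qExpansion 1 f).coeff (ℓ - D) = 1 ∧
  ∀ j, 1 ≤ j → j ≤ D → ‖(qExpansion 1 f).coeff (ℓ - D + j)‖ ≤ C

/-- The truncated exponential polynomial `Ex_D(t) = 1 + t + ⋯ + t^D / D!`. -/
def truncExp (D : ℕ) : ℂ[X] :=
  ∑ s ∈ Finset.range (D + 1), Polynomial.C (1 / (s.factorial : ℂ)) * X ^ s

end

/-! Write `Δ = q P` with `P = 1 - 24 q + ⋯`, `f = q ^ (ℓ - D) g`, and let `b s` be the coefficient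
of `t ^ (D - s)` in the Faber polynomial. Dividing `f = Δ ^ ℓ E_{k'} F(j)` by `q ^ (ℓ - D) P ^ ℓ
E_{k'}` gives `P ^ (-ℓ) g / E_{k'} = ∑ b s q ^ s J ^ (D - s)`, where `J = q j = E₄ ^ 3 / P` has
constant term 1. Comparing coefficients of `q ^ n`, `n ≤ D`, yields a unipotent triangular system
whose entries depend only on `D` (`IsFaberPolynomial.triangular`).

On the left, `P ^ (-ℓ) = (1 + 24 q + ⋯) ^ ℓ` has `n`-th coefficient `(24 ℓ) ^ n / n!` up to lower
powers of `ℓ`, and `24 ℓ = 2 k - 2 k'`. The factors `g` and `1 / E_{k'}` have constant term 1 and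
bounded coefficients, so they, like the triangular system, change only lower powers of `k`. Hence `b
n = (2 k) ^ n / n! (1 + O(1 / k))`, and rescaling `t` gives the claim.

Existence of `F` is by induction on `ℓ`, dividing cusp forms by `Δ`; uniqueness holds because the
leading coefficient is visible at the cusp. -/

/-! ### Uniform asymptotics of power series coefficients -/

section Asymptotics

open Asymptotics Filter PowerSeries

variable {ι : Type*} {x : ι → ℝ}

/-- The `n`-th terms of a family of sequences agree with `x ^ n / n!` up to a relative error
`O(1 / x)`, uniformly in the family. -/
def ExpLike (x : ι → ℝ) (u : ι → ℕ → ℂ) (n : ℕ) : Prop :=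
  (fun i ↦ u i n - (x i : ℂ) ^ n / (n.factorial : ℂ)) =O[⊤] fun i ↦ x i ^ n / x i

/-- Absorbs every lower-order term below. Along `⊤` a big-O is a bound at every index, not a limit,
hence the need for `1 ≤ x`. -/
lemma isBigO_pow_div_of_lt (hx : ∀ i, 1 ≤ x i) {m n : ℕ} (h : m < n) :
    (fun i ↦ x i ^ m) =O[⊤] fun i ↦ x i ^ n / x i := by
  refine IsBigO.of_bound 1 (eventually_top.mpr fun i ↦ ?_)
  have h0 : 0 < x i := zero_lt_one.trans_le (hx i)
  obtain ⟨n, rfl⟩ : ∃ p, n = p + 1 := ⟨n - 1, by omega⟩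
  rw [pow_succ, mul_div_cancel_right₀ _ h0.ne', one_mul, Real.norm_of_nonneg (by positivity),
    Real.norm_of_nonneg (by positivity)]
  exact pow_le_pow_right₀ (hx i) (by omega)

lemma ExpLike.isBigO_pow (hx : ∀ i, 1 ≤ x i) {u : ι → ℕ → ℂ} {n : ℕ} (h : ExpLike x u n) :
    (fun i ↦ u i n) =O[⊤] fun i ↦ x i ^ n := by
  have h1 : (fun i ↦ x i ^ n / x i) =O[⊤] fun i ↦ x i ^ n := by
    refine IsBigO.of_bound 1 (eventually_top.mpr fun i ↦ ?_)
    have h0 : 0 < x i := zero_lt_one.trans_le (hx i)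
    rw [one_mul, Real.norm_of_nonneg (by positivity), Real.norm_of_nonneg (by positivity)]
    exact div_le_self (by positivity) (hx i)
  have h2 : (fun i ↦ (x i : ℂ) ^ n / (n.factorial : ℂ)) =O[⊤] fun i ↦ x i ^ n := by
    refine IsBigO.of_bound (1 / (n.factorial : ℝ)) (eventually_top.mpr fun i ↦ le_of_eq ?_)
    simp [div_eq_inv_mul]
  simpa using (h.trans h1).add h2

/-- The coefficients of `Q ^ ℓ` are asymptotically those of `exp (a ℓ X)` if `Q = 1 + a X + ⋯`. -/
lemma expLike_coeff_pow (hx : ∀ i, 1 ≤ x i) {Q : ℂ⟦X⟧} {a : ℂ} (h0 : constantCoeff Q = 1)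
    (h1 : coeff 1 Q = a) {ℓ : ι → ℕ} (hℓ : (fun i ↦ (ℓ i : ℂ)) =O[⊤] x)
    (ha : (fun i ↦ (ℓ i : ℂ) * a - x i) =O[⊤] fun _ ↦ (1 : ℝ)) (n : ℕ) :
    ExpLike x (fun i m ↦ coeff m (Q ^ ℓ i)) n := by
  have hQ : Q * Q⁻¹ = 1 := PowerSeries.mul_inv_cancel _ (by simp [h0])
  -- The logarithmic derivative: `(Q ^ ℓ)' = ℓ L Q ^ ℓ` is a recursion for the coefficients in which
  -- `ℓ` enters linearly.
  set L : ℂ⟦X⟧ := Q⁻¹ * derivative ℂ Q with hL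
  have hL0 : coeff 0 L = a := by
    simp [hL, PowerSeries.coeff_mul, h0, PowerSeries.coeff_derivative, h1]
  have hder (m : ℕ) : derivative ℂ (Q ^ m) = m • (L * Q ^ m) := by
    rw [Derivation.leibniz_pow, hL]
    rcases m with _ | m
    · simp
    · simp only [Nat.add_sub_cancel, smul_eq_mul]
      congr 1
      linear_combination (-(Q ^ m * derivative ℂ Q)) * hQ
  induction n using Nat.strong_induction_on with
  | _ n ih =>
  rcases n with _ | n
  · simpa only [ExpLike, pow_zero, coeff_zero_eq_constantCoeff_apply, map_pow, h0, one_pow,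
      Nat.factorial_zero, Nat.cast_one, div_one, sub_self] using isBigO_zero _ _
  -- Only the term `j = n` of the recursion has full order; its factor `ℓ a` is `x` plus a bounded
  -- error.
  have hrec (i : ι) : coeff (n + 1) (Q ^ ℓ i) - (x i : ℂ) ^ (n + 1) / ((n + 1).factorial : ℂ) =
      (1 / (n + 1 : ℂ)) * (((ℓ i : ℂ) * a - x i) * coeff n (Q ^ ℓ i) +
        x i * (coeff n (Q ^ ℓ i) - (x i : ℂ) ^ n / (n.factorial : ℂ)) +
        ℓ i * ∑ j ∈ Finset.range n, coeff (n - j) L * coeff j (Q ^ ℓ i)) := by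
    have key := congrArg (PowerSeries.coeff n) (hder (ℓ i))
    rw [PowerSeries.coeff_derivative, map_nsmul, mul_comm L, PowerSeries.coeff_mul,
      Finset.Nat.sum_antidiagonal_eq_sum_range_succ_mk, Finset.sum_range_succ, nsmul_eq_mul,
      Nat.sub_self, hL0] at key
    simp_rw [mul_comm (coeff (n - _) L)]
    have hn : (n + 1 : ℂ) ≠ 0 := by exact_mod_cast n.succ_ne_zero
    have hf : (n.factorial : ℂ) ≠ 0 := by exact_mod_cast n.factorial_ne_zero
    rw [Nat.factorial_succ]
    push_cast
    field_simp
    linear_combination (n.factorial : ℂ) * key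
  simp only [ExpLike, hrec]
  refine IsBigO.const_mul_left ((IsBigO.add ?_ ?_).add ?_) _
  · have := ha.mul ((ih n n.lt_succ_self).isBigO_pow hx)
    simp only [one_mul] at this
    exact this.trans (isBigO_pow_div_of_lt hx n.lt_succ_self)
  · have hx' : (fun i ↦ (x i : ℂ)) =O[⊤] x :=
      IsBigO.of_bound 1 (eventually_top.mpr fun i ↦ by simp)
    refine (hx'.mul (ih n n.lt_succ_self)).congr_right fun i ↦ ?_
    rw [pow_succ]; ring
  · have hs : (fun i ↦ ∑ j ∈ Finset.range n, coeff (n - j) L * coeff j (Q ^ ℓ i)) =O[⊤]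
        fun i ↦ x i ^ n / x i := by
      refine IsBigO.fun_sum fun j hj ↦ IsBigO.const_mul_left ?_ _
      have hj := Finset.mem_range.mp hj
      exact ((ih j (by omega)).isBigO_pow hx).trans (isBigO_pow_div_of_lt hx hj)
    refine (hℓ.mul hs).congr_right fun i ↦ ?_
    rw [pow_succ]; ring

/-- Multiplication by a family of power series with constant coefficient `1` and bounded
coefficients does not change the leading asymptotics. -/
lemma ExpLike.coeff_mul (hx : ∀ i, 1 ≤ x i) {u v : ι → ℂ⟦X⟧} {n : ℕ}
    (hu : ∀ m ≤ n, ExpLike x (fun i m ↦ coeff m (u i)) m) (hv0 : ∀ i, constantCoeff (v i) = 1)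
    (hv : ∀ m ≤ n, (fun i ↦ coeff m (v i)) =O[⊤] fun _ ↦ (1 : ℝ)) :
    ExpLike x (fun i m ↦ coeff m (u i * v i)) n := by
  have hrec (i : ι) : coeff n (u i * v i) - (x i : ℂ) ^ n / (n.factorial : ℂ) =
      (coeff n (u i) - (x i : ℂ) ^ n / (n.factorial : ℂ)) +
        ∑ j ∈ Finset.range n, coeff j (u i) * coeff (n - j) (v i) := by
    rw [PowerSeries.coeff_mul, Finset.Nat.sum_antidiagonal_eq_sum_range_succ_mk,
      Finset.sum_range_succ, Nat.sub_self, coeff_zero_eq_constantCoeff_apply, hv0]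
    ring
  simp only [ExpLike, hrec]
  refine (hu n le_rfl).add (IsBigO.fun_sum fun j hj ↦ ?_)
  have hj := Finset.mem_range.mp hj
  have := ((hu j hj.le).isBigO_pow hx).mul (hv (n - j) (Nat.sub_le _ _))
  simp only [mul_one] at this
  exact this.trans (isBigO_pow_div_of_lt hx hj)

/-- A unipotent triangular system with bounded coefficients preserves the leading asymptotics. -/
lemma ExpLike.of_triangular (hx : ∀ i, 1 ≤ x i) {h b : ι → ℕ → ℂ} {M : ℕ → ℕ → ℂ} {D : ℕ}
    (hh : ∀ n ≤ D, ExpLike x h n)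
    (hb : ∀ i, ∀ n ≤ D, h i n = b i n + ∑ s ∈ Finset.range n, b i s * M n s) :
    ∀ n ≤ D, ExpLike x b n := by
  intro n
  induction n using Nat.strong_induction_on with
  | _ n ih =>
  intro hn
  have hrec (i : ι) : b i n - (x i : ℂ) ^ n / (n.factorial : ℂ) =
      (h i n - (x i : ℂ) ^ n / (n.factorial : ℂ)) - ∑ s ∈ Finset.range n, M n s * b i s := by
    simp_rw [hb i n hn, mul_comm (M n _)]
    ring
  simp only [ExpLike, hrec]
  refine (hh n hn).sub (IsBigO.fun_sum fun j hj ↦ IsBigO.const_mul_left ?_ _)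
  have hj := Finset.mem_range.mp hj
  exact ((ih j hj (by omega)).isBigO_pow hx).trans (isBigO_pow_div_of_lt hx hj)

end Asymptotics

/-! ### Level one forms and their first coefficients -/

section Eisenstein

open ModularForm EisensteinSeries

/-- The weights of the Eisenstein series that occur in Faber polynomials. -/
def faberWeights : Finset ℕ := {0, 4, 6, 8, 10, 14}

/-- `eisenstein k` as a modular form of weight `k`. -/
noncomputable def eisensteinForm (k : ℕ) : ModularForm 𝒮ℒ (k : ℤ) :=
  if hk : 3 ≤ k then ModularForm.E hk else if h0 : k = 0 then ModularForm.mcast (a := 0) (by simp [h0]) 1 else 0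

lemma coe_eisensteinForm {k : ℕ} (hk : k ∈ faberWeights) : ⇑(eisensteinForm k) = eisenstein k := by
  rcases Nat.eq_zero_or_pos k with rfl | h
  · simp [eisensteinForm, eisenstein]
  · have : 3 ≤ k := by simp only [faberWeights, Finset.mem_insert, Finset.mem_singleton] at hk; omega
    simp [eisensteinForm, eisenstein, this]

lemma coeff_zero_eisensteinForm {k : ℕ} (hk : k ∈ faberWeights) :
    (qExpansion 1 (eisensteinForm k)).coeff 0 = 1 := by
  rcases Nat.eq_zero_or_pos k with rfl | h
  · have : ⇑(eisensteinForm 0) = 1 := by rw [coe_eisensteinForm hk]; simp [eisenstein]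
    rw [this, qExpansion_one]
    simp
  · simp only [faberWeights, Finset.mem_insert, Finset.mem_singleton] at hk
    have h3 : 3 ≤ k := by omega
    have h2 : Even k := by rw [Nat.even_iff]; omega
    simp only [eisensteinForm, h3, dif_pos]
    exact E_qExpansion_coeff_zero h3 h2

/-- Weight 14 is congruent to 2 modulo 12, the exceptional case of the dimension formula, so it too
gives dimension 1. -/
lemma rank_faberWeight {k : ℕ} (hk : k ∈ faberWeights) :
    Module.rank ℂ (ModularForm 𝒮ℒ (k : ℤ)) = 1 := by
  have h2 : Even k := by
    simp only [faberWeights, Finset.mem_insert, Finset.mem_singleton] at hk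
    rw [Nat.even_iff]; omega
  rw [dimension_level_one k h2]
  simp only [faberWeights, Finset.mem_insert, Finset.mem_singleton] at hk
  rcases hk with rfl | rfl | rfl | rfl | rfl | rfl <;> norm_num [Nat.ModEq]

lemma exists_smul_eisensteinForm {k : ℕ} (hk : k ∈ faberWeights) (f : ModularForm 𝒮ℒ (k : ℤ)) :
    ∃ c : ℂ, c • eisensteinForm k = f := by
  refine (finrank_eq_one_iff_of_nonzero' (eisensteinForm k) fun h ↦ ?_).mp
    (Module.rank_eq_one_iff_finrank_eq_one.mp (rank_faberWeight hk)) f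
  have := coeff_zero_eisensteinForm hk
  rw [h] at this
  simp [qExpansion_zero] at this

lemma E₄_qExpansion_coeff_two : (qExpansion 1 E₄).coeff 2 = 2160 := by
  rw [E_qExpansion_coeff _ ⟨2, rfl⟩]
  norm_num [show _root_.bernoulli 4 = -1 / 30 by decide +kernel,
    show ArithmeticFunction.sigma 3 2 = 9 by decide +kernel]

lemma E₆_qExpansion_coeff_two : (qExpansion 1 E₆).coeff 2 = -16632 := by
  rw [E_qExpansion_coeff _ ⟨3, rfl⟩]
  norm_num [show _root_.bernoulli 6 = 1 / 42 by decide +kernel,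
    show ArithmeticFunction.sigma 5 2 = 33 by decide +kernel]

lemma qExpansion_discriminant : (1728 : ℂ) • qExpansion 1 discriminant =
    qExpansion 1 E₄ ^ 3 - qExpansion 1 E₆ ^ 2 := by
  have h : ((1728 : ℂ) • ⇑CuspForm.discriminant : ℍ → ℂ) = ⇑(E₄.pow 3) - ⇑(E₆.pow 2) := by
    ext z
    simp only [Pi.smul_apply, CuspForm.coe_discriminant, discriminant_eq_E₄_cube_sub_E₆_sq,
      smul_eq_mul, Pi.sub_apply, ModularForm.coe_pow, Pi.pow_apply]
    ring
  have h3 := ModularForm.qExpansion_smul one_pos one_mem_strictPeriods_SL (1728 : ℂ)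
    CuspForm.discriminant
  have h4 : qExpansion 1 (⇑(E₄.pow 3) - ⇑(E₆.pow 2)) =
      qExpansion 1 (E₄.pow 3) - qExpansion 1 (E₆.pow 2) :=
    ModularForm.qExpansion_sub one_pos one_mem_strictPeriods_SL (E₄.pow 3)
      (ModularForm.mcast (by norm_num) (E₆.pow 2) : ModularForm 𝒮ℒ (3 * 4))
  rw [← CuspForm.coe_discriminant, ← h3, h, h4,
    ModularForm.qExpansion_pow one_pos one_mem_strictPeriods_SL,
    ModularForm.qExpansion_pow one_pos one_mem_strictPeriods_SL]

/-- Read off from `1728 Δ = E₄ ^ 3 - E₆ ^ 2`. This `-24` is the source of the scale `24 ℓ ≈ 2 k`. -/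
lemma discriminant_qExpansion_coeff_two : (qExpansion 1 discriminant).coeff 2 = -24 := by
  have h := congrArg (PowerSeries.coeff 2) qExpansion_discriminant
  have e40 : PowerSeries.constantCoeff (qExpansion 1 E₄) = 1 := by
    simpa using E_qExpansion_coeff_zero (by norm_num : 3 ≤ 4) ⟨2, rfl⟩
  have e60 : PowerSeries.constantCoeff (qExpansion 1 E₆) = 1 := by
    simpa using E_qExpansion_coeff_zero (by norm_num : 3 ≤ 6) ⟨3, rfl⟩
  simp only [map_smul, map_sub, pow_succ, pow_zero, one_mul, PowerSeries.coeff_mul,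
    Finset.Nat.antidiagonal_succ, smul_eq_mul] at h
  simp [Finset.Nat.antidiagonal_succ, E₄_qExpansion_coeff_one,
    E₆_qExpansion_coeff_one, E₄_qExpansion_coeff_two, E₆_qExpansion_coeff_two, e40, e60] at h
  linear_combination h / 1728

/-- `Δ / q = 1 - 24 q + ⋯` as a power series. -/
lemma exists_qExpansion_discriminant_eq_X_mul : ∃ P : PowerSeries ℂ,
    qExpansion 1 discriminant = PowerSeries.X * P ∧ PowerSeries.constantCoeff P = 1 ∧
      PowerSeries.coeff 1 P = -24 := by
  have h0 : PowerSeries.constantCoeff (qExpansion 1 discriminant) = 0 := by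
    simpa using CuspFormClass.qExpansion_coeff_zero CuspForm.discriminant one_pos
      one_mem_strictPeriods_SL
  obtain ⟨P, hP⟩ := PowerSeries.X_dvd_iff.mpr h0
  refine ⟨P, hP, ?_, ?_⟩
  · rw [← discriminant_qExpansion_coeff_one, hP, PowerSeries.coeff_succ_X_mul,
      PowerSeries.coeff_zero_eq_constantCoeff_apply]
  · rw [← discriminant_qExpansion_coeff_two, hP, PowerSeries.coeff_succ_X_mul]

end Eisenstein

/-! ### Existence and uniqueness of Faber polynomials -/

section Faber

open ModularForm EisensteinSeries

lemma kleinJ_mul_discriminant (τ : ℍ) : kleinJ τ * discriminant τ = E₄ τ ^ 3 :=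
  div_mul_cancel₀ _ (discriminant_ne_zero τ)

lemma discriminant_pow_mul_kleinJ_pow {N s : ℕ} (h : s ≤ N) (τ : ℍ) :
    discriminant τ ^ N * kleinJ τ ^ s = discriminant τ ^ (N - s) * E₄ τ ^ (3 * s) := by
  obtain ⟨m, rfl⟩ := Nat.exists_eq_add_of_le h
  rw [Nat.add_sub_cancel_left, pow_mul, ← kleinJ_mul_discriminant, mul_pow, pow_add]
  ring

/-- For `s ≤ N` the zero of `Δ ^ N` at the cusp cancels the pole of `j ^ s`. -/
lemma exists_form_eq_monomial {k' : ℕ} (hk : k' ∈ faberWeights) {N s : ℕ} (h : s ≤ N) :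
    ∃ g : ModularForm 𝒮ℒ ((12 * N + k' : ℕ) : ℤ),
      (∀ τ, g τ = discriminant τ ^ N * eisenstein k' τ * kleinJ τ ^ s) ∧
      qExpansion 1 g = qExpansion 1 discriminant ^ (N - s) * qExpansion 1 E₄ ^ (3 * s) *
        qExpansion 1 (eisensteinForm k') := by
  let d : ModularForm 𝒮ℒ 12 := CuspForm.toModularFormₗ CuspForm.discriminant
  have hd : ⇑d = discriminant := rfl
  refine ⟨ModularForm.mcast ?_ (((d.pow (N - s)).mul (E₄.pow (3 * s))).mul (eisensteinForm k')),
    fun τ ↦ ?_, ?_⟩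
  · push_cast [h]
    ring
  · simp only [coe_mcast, ModularForm.coe_mul, ModularForm.coe_pow, Pi.mul_apply, Pi.pow_apply, hd,
      coe_eisensteinForm hk]
    rw [mul_right_comm, mul_right_comm (discriminant τ ^ N), discriminant_pow_mul_kleinJ_pow h,
      mul_right_comm]
  · simp only [ModularForm.qExpansion_mcast,
      ModularForm.qExpansion_mul one_pos one_mem_strictPeriods_SL,
      ModularForm.qExpansion_pow one_pos one_mem_strictPeriods_SL, hd]

lemma IsFaberPolynomial.qExpansion_eq {k' : ℕ} (hk : k' ∈ faberWeights) {N : ℕ} {f : ℍ → ℂ}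
    {F : ℂ[X]} (hF : IsFaberPolynomial N k' f F) (hN : F.natDegree ≤ N) :
    qExpansion 1 f = ∑ s ∈ Finset.range (N + 1), F.coeff s •
      (qExpansion 1 discriminant ^ (N - s) * qExpansion 1 E₄ ^ (3 * s) *
        qExpansion 1 (eisensteinForm k')) := by
  choose! g hg hgq using fun s (h : s ≤ N) ↦ exists_form_eq_monomial hk h
  have hf : f = ⇑(∑ s ∈ Finset.range (N + 1), F.coeff s • g s) := by
    ext τ
    rw [hF τ, eval_eq_sum_range' (Nat.lt_succ_of_le hN), FunLike.coe_sum, Finset.sum_apply,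
      Finset.mul_sum]
    refine Finset.sum_congr rfl fun s hs ↦ ?_
    rw [FunLike.coe_smul, Pi.smul_apply, hg s (by simpa [Nat.lt_succ_iff] using hs), smul_eq_mul]
    ring
  have hsum := map_sum (qExpansionAddHom (Γ := 𝒮ℒ) one_pos one_mem_strictPeriods_SL
    ((12 * N + k' : ℕ) : ℤ)) (fun s ↦ F.coeff s • g s) (Finset.range (N + 1))
  simp only [qExpansionAddHom, AddMonoidHom.coe_mk, ZeroHom.coe_mk] at hsum
  rw [hf, hsum]
  refine Finset.sum_congr rfl fun s hs ↦ ?_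
  rw [FunLike.coe_smul, ModularForm.qExpansion_smul one_pos one_mem_strictPeriods_SL,
    hgq s (by simpa [Nat.lt_succ_iff] using hs)]

lemma IsFaberPolynomial.eq_zero {k' : ℕ} (hk : k' ∈ faberWeights) {ℓ : ℕ} {F : ℂ[X]}
    (hF : IsFaberPolynomial ℓ k' 0 F) : F = 0 := by
  -- As `Δ` has no zeros, its exponent may be changed to `deg F`. Then only the top monomial
  -- survives at `q = 0`, so the leading coefficient is 0.
  have hF' : IsFaberPolynomial F.natDegree k' 0 F := fun τ ↦ by
    have h := hF τ
    rw [Pi.zero_apply, mul_assoc, eq_comm,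
      mul_eq_zero_iff_left (pow_ne_zero _ (discriminant_ne_zero τ))] at h
    rw [mul_assoc, h, mul_zero, Pi.zero_apply]
  have hq := congrArg PowerSeries.constantCoeff (hF'.qExpansion_eq hk le_rfl)
  have h0 : PowerSeries.constantCoeff (qExpansion 1 discriminant) = 0 := by
    simpa using CuspFormClass.qExpansion_coeff_zero CuspForm.discriminant one_pos
      one_mem_strictPeriods_SL
  have h4 : PowerSeries.constantCoeff (qExpansion 1 E₄) = 1 := by
    simpa using E_qExpansion_coeff_zero (by norm_num : 3 ≤ 4) ⟨2, rfl⟩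
  have he : PowerSeries.constantCoeff (qExpansion 1 (eisensteinForm k')) = 1 := by
    simpa using coeff_zero_eisensteinForm hk
  rw [Finset.sum_range_succ, map_add, map_sum, Finset.sum_eq_zero, zero_add, qExpansion_zero] at hq
  · simpa [h4, he] using hq.symm
  · intro s hs
    have hs := Finset.mem_range.mp hs
    rw [PowerSeries.constantCoeff_smul, map_mul, map_mul, map_pow, h0, zero_pow (by omega)]
    simp

lemma IsFaberPolynomial.unique {k' : ℕ} (hk : k' ∈ faberWeights) {ℓ : ℕ} {f : ℍ → ℂ} {F G : ℂ[X]}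
    (hF : IsFaberPolynomial ℓ k' f F) (hG : IsFaberPolynomial ℓ k' f G) : F = G := by
  refine sub_eq_zero.mp (IsFaberPolynomial.eq_zero hk (ℓ := ℓ) fun τ ↦ ?_)
  rw [eval_sub, mul_sub, ← hF τ, ← hG τ, sub_self, Pi.zero_apply]

/-- Subtracting a multiple of `Δ ^ ℓ E_{k'} j ^ ℓ` leaves a cusp form, which is `Δ` times a form of
weight 12 less. At `ℓ = 0` the space is spanned by `E_{k'}`. -/
lemma exists_isFaberPolynomial {k' : ℕ} (hk : k' ∈ faberWeights) (ℓ : ℕ) :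
    ∀ D ≤ ℓ, ∀ f : ModularForm 𝒮ℒ ((12 * ℓ + k' : ℕ) : ℤ),
      (∀ n < ℓ - D, (qExpansion 1 f).coeff n = 0) →
      ∃ F : ℂ[X], F.natDegree ≤ D ∧ IsFaberPolynomial ℓ k' f F := by
  induction ℓ with
  | zero =>
    intro D _ f _
    have hw : ((12 * 0 + k' : ℕ) : ℤ) = k' := by simp
    obtain ⟨c, hc⟩ := exists_smul_eisensteinForm hk (ModularForm.mcast hw f)
    refine ⟨Polynomial.C c, by simp, fun τ ↦ ?_⟩
    have := DFunLike.congr_fun hc τ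
    rw [FunLike.coe_smul, Pi.smul_apply, coe_eisensteinForm hk, coe_mcast] at this
    rw [← this]
    simp [mul_comm]
  | succ ℓ ih =>
    intro D hD f hf
    obtain ⟨g, hg, hgq⟩ := exists_form_eq_monomial hk (le_refl (ℓ + 1))
    set a := (qExpansion 1 f).coeff 0 with ha
    have h4 : PowerSeries.constantCoeff (qExpansion 1 E₄) = 1 := by
      simpa using E_qExpansion_coeff_zero (by norm_num : 3 ≤ 4) ⟨2, rfl⟩
    have he : PowerSeries.constantCoeff (qExpansion 1 (eisensteinForm k')) = 1 := by
      simpa using coeff_zero_eisensteinForm hk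
    have hg0 : (qExpansion 1 g).coeff 0 = 1 := by
      rw [hgq]
      simp [h4, he]
    have hcusp := (isCuspForm_iff_coeffZero_eq_zero _).mp (sub_smul_isCuspForm f g hg0)
    set u := f - a • g with hu
    let v : ModularForm 𝒮ℒ ((12 * ℓ + k' : ℕ) : ℤ) :=
      ModularForm.mcast (by push_cast; ring) (CuspForm.discriminantEquiv (toCuspForm u hcusp))
    have huv (τ : ℍ) : u τ = discriminant τ * v τ :=
      (discriminant_mul_discriminantEquiv_apply (toCuspForm u hcusp) τ).symm
    have huvq : qExpansion 1 u = qExpansion 1 discriminant * qExpansion 1 v :=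
      qExpansion_eq_qExpansion_discriminant_mul u hcusp
    have hfu (τ : ℍ) : f τ = u τ + a * g τ := by
      simp [hu]
    have hJ (G : ℂ[X]) (hG : IsFaberPolynomial ℓ k' v G) :
        IsFaberPolynomial (ℓ + 1) k' f (G + Polynomial.C a * X ^ (ℓ + 1)) := fun τ ↦ by
      rw [hfu, huv, hG τ, hg τ]
      simp only [eval_add, eval_mul, eval_C, eval_pow, eval_X]
      ring
    -- If `D = ℓ + 1`, the subtracted monomial supplies the top degree. Otherwise `a = 0`, and
    -- dividing by `Δ` lowers both `ℓ` and the order of vanishing by one, keeping `D`.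
    rcases hD.eq_or_lt with rfl | hlt
    · obtain ⟨G, hGdeg, hG⟩ := ih ℓ le_rfl v (by simp)
      refine ⟨_, natDegree_add_le_of_degree_le (by omega) (natDegree_C_mul_X_pow_le _ _), hJ G hG⟩
    · have ha0 : a = 0 := hf 0 (by omega)
      obtain ⟨P, hP, hP0, -⟩ := exists_qExpansion_discriminant_eq_X_mul
      have hdvd : PowerSeries.X ^ (ℓ - D) ∣ qExpansion 1 v := by
        have h1 : (PowerSeries.X : PowerSeries ℂ) ^ (ℓ + 1 - D) ∣ qExpansion 1 u := by
          rw [show u = f by simp [hu, ha0]]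
          exact PowerSeries.X_pow_dvd_iff.mpr hf
        have hPP : P * P⁻¹ = 1 := PowerSeries.mul_inv_cancel _ (by simp [hP0])
        rw [huvq, hP, show ℓ + 1 - D = ℓ - D + 1 by omega, pow_succ', mul_assoc] at h1
        have h2 := (mul_dvd_mul_iff_left PowerSeries.X_ne_zero).mp h1
        have h3 := h2.mul_left P⁻¹
        rwa [← mul_assoc, mul_comm P⁻¹, hPP, one_mul] at h3
      obtain ⟨G, hGdeg, hG⟩ := ih D (by omega) v (PowerSeries.X_pow_dvd_iff.mp hdvd)
      refine ⟨G, hGdeg, ?_⟩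
      simpa [ha0] using hJ G hG

end Faber

/-! ### The triangular system and its uniform solution -/

section Coefficients

open ModularForm EisensteinSeries Asymptotics Filter

lemma exists_bound_of_expLike {ι : Type*} {k : ι → ℕ} (hk : ∀ i, 1 ≤ k i) {b : ι → ℕ → ℂ} {D : ℕ}
    (h : ∀ n ≤ D, ExpLike (fun i ↦ 2 * (k i : ℝ)) b n) :
    ∃ K : ℝ, 0 < K ∧ ∀ i, ∀ n ≤ D,
      ‖b i n * (n.factorial : ℂ) / (2 * (k i : ℂ)) ^ n - 1‖ ≤ K / k i := by
  have hb (n : ℕ) : ∃ K : ℝ, 0 < K ∧ (n ≤ D → ∀ i,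
      ‖b i n * (n.factorial : ℂ) / (2 * (k i : ℂ)) ^ n - 1‖ ≤ K / k i) := by
    by_cases hn : n ≤ D
    · obtain ⟨c, hc, hbd⟩ := (h n hn).exists_pos
      refine ⟨c * n.factorial, by positivity, fun _ i ↦ ?_⟩
      have hki : (0 : ℝ) < k i := by exact_mod_cast hk i
      have hki' : (k i : ℂ) ≠ 0 := by exact_mod_cast hki.ne'
      have hf : (n.factorial : ℂ) ≠ 0 := by exact_mod_cast n.factorial_ne_zero
      have hi := eventually_top.mp hbd.bound i
      rw [Real.norm_of_nonneg (by positivity)] at hi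
      have heq : b i n * (n.factorial : ℂ) / (2 * (k i : ℂ)) ^ n - 1 =
          (b i n - ((2 * (k i : ℝ) : ℝ) : ℂ) ^ n / (n.factorial : ℂ)) *
            ((n.factorial : ℂ) / (2 * (k i : ℂ)) ^ n) := by
        push_cast
        field_simp
      have hnorm : ‖(n.factorial : ℂ) / (2 * (k i : ℂ)) ^ n‖ =
          (n.factorial : ℝ) / (2 * (k i : ℝ)) ^ n := by simp
      rw [heq, norm_mul, hnorm]
      calc _ ≤ c * ((2 * (k i : ℝ)) ^ n / (2 * k i)) *
            ((n.factorial : ℝ) / (2 * (k i : ℝ)) ^ n) := by gcongr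
        _ = c * n.factorial / (2 * k i) := by field_simp
        _ ≤ c * n.factorial / k i := by
          gcongr
          linarith
    · exact ⟨1, one_pos, fun h ↦ absurd h hn⟩
  choose K hK hKb using hb
  refine ⟨∑ n ∈ Finset.range (D + 1), K n, Finset.sum_pos (fun n _ ↦ hK n) (by simp),
    fun i n hn ↦ (hKb n hn i).trans ?_⟩
  gcongr
  exact Finset.single_le_sum (fun m _ ↦ (hK m).le) (Finset.mem_range.mpr (Nat.lt_succ_of_le hn))

open PowerSeries in
/-- The coefficients `b n` determined by a leading part `g` of a `q`-expansion are asymptotic to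
`(2 k) ^ n / n!`. -/
lemma exists_bound_of_triangular (D : ℕ) (C : ℝ) {P : ℂ⟦X⟧} (hP0 : constantCoeff P = 1)
    (hP1 : PowerSeries.coeff 1 P = -24) (e : ℕ → ℂ⟦X⟧) (S : Finset ℕ)
    (he : ∀ k' ∈ S, constantCoeff (e k') = 1) (J : ℂ⟦X⟧) :
    ∃ K : ℝ, 0 < K ∧ ∀ k ℓ k' : ℕ, k' ∈ S → k = 12 * ℓ + k' → 1 ≤ k → ∀ g : ℂ⟦X⟧,
      constantCoeff g = 1 → (∀ m ≤ D, ‖PowerSeries.coeff m g‖ ≤ C) → ∀ b : ℕ → ℂ,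
      (∀ n ≤ D, PowerSeries.coeff n (P⁻¹ ^ ℓ * g * (e k')⁻¹) =
        b n + ∑ s ∈ Finset.range n, b s * PowerSeries.coeff (n - s) (J ^ (D - s))) →
      ∀ n ≤ D, ‖b n * (n.factorial : ℂ) / (2 * (k : ℂ)) ^ n - 1‖ ≤ K / k := by
  -- All admissible data form one index type, so a big-O along `⊤` gives a constant independent of
  -- `k`, `g` and `b`.
  let ι := {p : (ℕ × ℕ × ℕ) × ℂ⟦X⟧ × (ℕ → ℂ) //
    p.1.2.2 ∈ S ∧ p.1.1 = 12 * p.1.2.1 + p.1.2.2 ∧ 1 ≤ p.1.1 ∧ constantCoeff p.2.1 = 1 ∧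
    (∀ m ≤ D, ‖PowerSeries.coeff m p.2.1‖ ≤ C) ∧
    (∀ n ≤ D, PowerSeries.coeff n (P⁻¹ ^ p.1.2.1 * p.2.1 * (e p.1.2.2)⁻¹) =
      p.2.2 n + ∑ s ∈ Finset.range n, p.2.2 s * PowerSeries.coeff (n - s) (J ^ (D - s)))}
  have hx (i : ι) : 1 ≤ 2 * (i.1.1.1 : ℝ) := by
    have : (1 : ℝ) ≤ i.1.1.1 := by exact_mod_cast i.2.2.2.1
    linarith
  have hPinv0 : constantCoeff P⁻¹ = 1 := by simp [hP0]
  have hPinv1 : PowerSeries.coeff 1 P⁻¹ = 24 := by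
    have h := congrArg (PowerSeries.coeff 1) (PowerSeries.mul_inv_cancel P (by simp [hP0]))
    simp only [PowerSeries.coeff_mul, Finset.Nat.antidiagonal_succ] at h
    simp [hP0, hP1, PowerSeries.coeff_one] at h
    linear_combination h
  have hℓ : (fun i : ι ↦ (i.1.1.2.1 : ℂ)) =O[⊤] fun i ↦ 2 * (i.1.1.1 : ℝ) := by
    refine IsBigO.of_bound 1 (eventually_top.mpr fun i ↦ ?_)
    have h : (i.1.1.1 : ℝ) = 12 * i.1.1.2.1 + i.1.1.2.2 := by exact_mod_cast i.2.2.1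
    rw [Real.norm_of_nonneg (by positivity), Complex.norm_natCast, h]
    have h1 : (0 : ℝ) ≤ i.1.1.2.1 := by positivity
    have h2 : (0 : ℝ) ≤ i.1.1.2.2 := by positivity
    linarith
  have ha : (fun i : ι ↦ (i.1.1.2.1 : ℂ) * 24 - ((2 * (i.1.1.1 : ℝ) : ℝ) : ℂ)) =O[⊤]
      fun _ ↦ (1 : ℝ) := by
    refine IsBigO.of_bound (2 * (S.sup id : ℕ)) (eventually_top.mpr fun i ↦ ?_)
    have h : (i.1.1.1 : ℂ) = 12 * i.1.1.2.1 + i.1.1.2.2 := by exact_mod_cast i.2.2.1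
    have heq : (i.1.1.2.1 : ℂ) * 24 - ((2 * (i.1.1.1 : ℝ) : ℝ) : ℂ) = -(2 * (i.1.1.2.2 : ℂ)) := by
      push_cast
      rw [h]
      ring
    have hle : i.1.1.2.2 ≤ S.sup id := Finset.le_sup (f := id) i.2.1
    rw [heq, norm_neg, norm_mul, Complex.norm_natCast]
    simpa using hle
  have hpow (n : ℕ) := expLike_coeff_pow hx hPinv0 hPinv1 hℓ ha n
  have hg (n : ℕ) (hn : n ≤ D) := ExpLike.coeff_mul hx (u := fun i : ι ↦ P⁻¹ ^ i.1.1.2.1)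
    (v := fun i ↦ i.1.2.1) (n := n) (fun m _ ↦ hpow m) (fun i ↦ i.2.2.2.2.1)
    (fun m hm ↦ IsBigO.of_bound C (eventually_top.mpr fun i ↦ by
      simpa using i.2.2.2.2.2.1 m (hm.trans hn)))
  have hh (n : ℕ) (hn : n ≤ D) := ExpLike.coeff_mul hx
    (u := fun i : ι ↦ P⁻¹ ^ i.1.1.2.1 * i.1.2.1) (v := fun i ↦ (e i.1.1.2.2)⁻¹) (n := n)
    (fun m hm ↦ hg m (hm.trans hn)) (fun i ↦ by simp [he _ i.2.1])
    (fun m hm ↦ IsBigO.of_bound (∑ j ∈ S, ‖PowerSeries.coeff m (e j)⁻¹‖)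
      (eventually_top.mpr fun i ↦ by
        simpa using Finset.single_le_sum (f := fun j ↦ ‖PowerSeries.coeff m (e j)⁻¹‖)
          (fun j _ ↦ norm_nonneg _) i.2.1))
  obtain ⟨K, hK, hb⟩ := exists_bound_of_expLike (k := fun i : ι ↦ i.1.1.1) (b := fun i ↦ i.1.2.2)
    (fun i ↦ i.2.2.2.1) (ExpLike.of_triangular hx hh fun i n hn ↦ i.2.2.2.2.2.2 n hn)
  exact ⟨K, hK, fun k ℓ k' hk' hk hk1 g hg0 hgb b hb' n hn ↦
    hb ⟨((k, ℓ, k'), g, b), hk', hk, hk1, hg0, hgb, hb'⟩ n hn⟩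

open PowerSeries in
/-- The triangular system satisfied by the coefficients of a Faber polynomial. -/
lemma IsFaberPolynomial.triangular {k' : ℕ} (hk : k' ∈ faberWeights) {D ℓ : ℕ} (hD : D ≤ ℓ)
    {f : ℍ → ℂ} {F : ℂ[X]} (hF : IsFaberPolynomial ℓ k' f F) (hdeg : F.natDegree ≤ D)
    {P g : ℂ⟦X⟧} (hP : qExpansion 1 discriminant = PowerSeries.X * P)
    (hP0 : constantCoeff P = 1) (hg : qExpansion 1 f = PowerSeries.X ^ (ℓ - D) * g) {n : ℕ}
    (hn : n ≤ D) :
    PowerSeries.coeff n (P⁻¹ ^ ℓ * g * (qExpansion 1 (eisensteinForm k'))⁻¹) =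
      F.coeff (D - n) + ∑ s ∈ Finset.range n, F.coeff (D - s) *
        PowerSeries.coeff (n - s) ((qExpansion 1 E₄ ^ 3 * P⁻¹) ^ (D - s)) := by
  set A := qExpansion 1 E₄ with hA
  set B := qExpansion 1 (eisensteinForm k') with hB
  have hA0 : constantCoeff A = 1 := by
    simpa using E_qExpansion_coeff_zero (by norm_num : 3 ≤ 4) ⟨2, rfl⟩
  have hB0 : constantCoeff B = 1 := by simpa using coeff_zero_eisensteinForm hk
  have hPP : P * P⁻¹ = 1 := PowerSeries.mul_inv_cancel _ (by simp [hP0])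
  have hBB : B * B⁻¹ = 1 := PowerSeries.mul_inv_cancel _ (by simp [hB0])
  have hsum : g = ∑ s ∈ Finset.range (D + 1), F.coeff (D - s) •
      (PowerSeries.X ^ s * P ^ (ℓ - D + s) * A ^ (3 * (D - s)) * B) := by
    have h := hF.qExpansion_eq hk (hdeg.trans hD)
    rw [hg, hP, ← hA, ← hB] at h
    refine mul_left_cancel₀ (pow_ne_zero (ℓ - D) PowerSeries.X_ne_zero) (h.trans ?_)
    rw [← Finset.sum_subset (Finset.range_mono (Nat.succ_le_succ hD)) fun s _ hs ↦ ?_,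
      ← Finset.sum_range_reflect, Finset.mul_sum]
    · refine Finset.sum_congr rfl fun s hs ↦ ?_
      have hs : s ≤ D := Nat.lt_succ_iff.mp (Finset.mem_range.mp hs)
      rw [Nat.succ_sub_one, show ℓ - (D - s) = ℓ - D + s by omega, mul_smul_comm]
      congr 1
      ring
    · rw [coeff_eq_zero_of_natDegree_lt, zero_smul]
      have : D < s := by simpa using hs
      omega
  have hmain : P⁻¹ ^ ℓ * g * B⁻¹ = ∑ s ∈ Finset.range (D + 1), F.coeff (D - s) •
      (PowerSeries.X ^ s * (A ^ 3 * P⁻¹) ^ (D - s)) := by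
    rw [hsum, Finset.mul_sum, Finset.sum_mul]
    refine Finset.sum_congr rfl fun s hs ↦ ?_
    have hs : s ≤ D := Nat.lt_succ_iff.mp (Finset.mem_range.mp hs)
    -- These leftover powers of `P⁻¹` combine with `A ^ (3 * (D - s))` into `J ^ (D - s)`.
    have hℓ : P⁻¹ ^ ℓ * P ^ (ℓ - D + s) = P⁻¹ ^ (D - s) := by
      rw [show ℓ = (ℓ - D + s) + (D - s) by omega, pow_add,
        show ℓ - D + s + (D - s) - D + s = ℓ - D + s by omega, mul_right_comm, ← mul_pow,
        mul_comm P⁻¹, hPP, one_pow, one_mul]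
    rw [mul_smul_comm, smul_mul_assoc, mul_pow, ← hℓ, pow_mul]
    congr 1
    linear_combination (P⁻¹ ^ ℓ * PowerSeries.X ^ s * P ^ (ℓ - D + s) * (A ^ 3) ^ (D - s)) * hBB
  rw [hmain, map_sum, ← Finset.sum_subset (Finset.range_mono (Nat.succ_le_succ hn)) fun s _ hs ↦ ?_,
    Finset.sum_range_succ, add_comm]
  · congr 1
    · rw [PowerSeries.coeff_smul, PowerSeries.coeff_X_pow_mul', if_pos le_rfl, Nat.sub_self]
      simp [hA0, hP0]
    · refine Finset.sum_congr rfl fun s hs ↦ ?_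
      have hs := Finset.mem_range.mp hs
      rw [PowerSeries.coeff_smul, PowerSeries.coeff_X_pow_mul', if_pos hs.le, smul_eq_mul]
  · have hs : n < s := by simpa using hs
    rw [PowerSeries.coeff_smul, PowerSeries.coeff_X_pow_mul', if_neg (by omega), smul_zero]

end Coefficients

/-! ### From coefficients to the rescaled polynomial -/

section Rescaling

lemma coeff_truncExp {D s : ℕ} (hs : s ≤ D) : (truncExp D).coeff s = 1 / (s.factorial : ℂ) := by
  simp only [truncExp, finsetSum_coeff, coeff_C_mul, coeff_X_pow]
  simp [Nat.lt_succ_of_le hs]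

lemma eval_truncExp (D : ℕ) (z : ℂ) :
    (truncExp D).eval z = ∑ s ∈ Finset.range (D + 1), 1 / (s.factorial : ℂ) * z ^ s := by
  simp [truncExp, eval_finsetSum]

lemma norm_eval_truncExp_ofReal (D : ℕ) {r : ℝ} (hr : 0 ≤ r) :
    ‖(truncExp D).eval (1 / (r : ℂ))‖ =
      ∑ s ∈ Finset.range (D + 1), 1 / (s.factorial : ℝ) * (1 / r) ^ s := by
  have h : (truncExp D).eval (1 / (r : ℂ)) =
      ((∑ s ∈ Finset.range (D + 1), 1 / (s.factorial : ℝ) * (1 / r) ^ s : ℝ) : ℂ) := by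
    rw [eval_truncExp]
    push_cast
    rfl
  rw [h, Complex.norm_real, Real.norm_of_nonneg (by positivity)]

/-- Comparing coefficients forces `ε s = b s * s! / y ^ s - 1`. -/
lemma rescaled_eval_eq {D : ℕ} {F : ℂ[X]} (hF : F.natDegree ≤ D) {y : ℂ} (hy : y ≠ 0) {t : ℂ}
    (ht : t ≠ 0) : 1 / y ^ D * F.eval (y * t) =
      t ^ D * ∑ s ∈ Finset.range (D + 1), (truncExp D).coeff s * (1 / t) ^ s *
        (1 + (F.coeff (D - s) * (s.factorial : ℂ) / y ^ s - 1)) := by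
  rw [eval_eq_sum_range' (Nat.lt_succ_of_le hF), ← Finset.sum_range_reflect, Finset.mul_sum,
    Finset.mul_sum]
  refine Finset.sum_congr rfl fun s hs ↦ ?_
  have hs : s ≤ D := Nat.lt_succ_iff.mp (Finset.mem_range.mp hs)
  obtain ⟨m, rfl⟩ := Nat.exists_eq_add_of_le hs
  have hf : (s.factorial : ℂ) ≠ 0 := by exact_mod_cast s.factorial_ne_zero
  rw [coeff_truncExp hs, Nat.succ_sub_one, Nat.add_sub_cancel_left, add_sub_cancel, mul_pow,
    pow_add, pow_add, one_div_pow]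
  field_simp

lemma norm_sub_truncExp_le {D : ℕ} {ε : ℕ → ℂ} {κ : ℝ} (hε : ∀ s ≤ D, ‖ε s‖ ≤ κ) (t : ℂ) :
    ‖t ^ D * ∑ s ∈ Finset.range (D + 1), (truncExp D).coeff s * (1 / t) ^ s * (1 + ε s) -
      t ^ D * (truncExp D).eval (1 / t)‖ ≤
      κ * (‖t‖ ^ D * ‖(truncExp D).eval (1 / (‖t‖ : ℂ))‖) := by
  have h : ∑ s ∈ Finset.range (D + 1), (truncExp D).coeff s * (1 / t) ^ s * (1 + ε s) -
      (truncExp D).eval (1 / t) =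
      ∑ s ∈ Finset.range (D + 1), 1 / (s.factorial : ℂ) * (1 / t) ^ s * ε s := by
    rw [eval_truncExp, ← Finset.sum_sub_distrib]
    refine Finset.sum_congr rfl fun s hs ↦ ?_
    rw [coeff_truncExp (Nat.lt_succ_iff.mp (Finset.mem_range.mp hs))]
    ring
  rw [← mul_sub, h, norm_mul, norm_pow, norm_eval_truncExp_ofReal D (norm_nonneg t),
    mul_left_comm κ]
  gcongr
  rw [Finset.mul_sum]
  refine norm_sum_le_of_le _ fun s hs ↦ ?_
  rw [norm_mul, mul_comm κ]
  have h1 : ‖1 / (s.factorial : ℂ) * (1 / t) ^ s‖ = 1 / (s.factorial : ℝ) * (1 / ‖t‖) ^ s := by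
    simp
  rw [h1]
  gcongr
  exact hε s (Nat.lt_succ_iff.mp (Finset.mem_range.mp hs))

end Rescaling

theorem theorem1p2 (D : ℕ) (C : ℝ) (hC : 0 < C) :
    -- the implied constant depends only on `D` and `C`
    ∃ K : ℝ, 0 < K ∧
      ∀ k ℓ k' : ℕ, k' ∈ ({0, 4, 6, 8, 10, 14} : Set ℕ) → k = 12 * ℓ + k' →
      ∀ f : CuspForm 𝒮ℒ (k : ℤ), HasLeadingTerms D C ℓ f →
        -- the Faber polynomial of `f` is well defined
        (∃! F : ℂ[X], IsFaberPolynomial ℓ k' f F) ∧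
        ∀ F : ℂ[X], IsFaberPolynomial ℓ k' f F →
          F.natDegree = D ∧
          -- each coefficient of `t^D Ex_D(1/t)` is multiplied by a factor `1 + O(1/k)`
          (∃ ε : ℕ → ℂ, (∀ s ≤ D, ‖ε s‖ ≤ K / k) ∧
            ∀ t : ℂ, t ≠ 0 →
              1 / (2 * (k : ℂ)) ^ D * F.eval (2 * k * t) =
                t ^ D * ∑ s ∈ Finset.range (D + 1),
                  (truncExp D).coeff s * (1 / t) ^ s * (1 + ε s)) ∧
          -- the resulting pointwise bound, for all complex `t ≠ 0`
          (∀ t : ℂ, t ≠ 0 →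
            ‖1 / (2 * (k : ℂ)) ^ D * F.eval (2 * k * t) - t ^ D * (truncExp D).eval (1 / t)‖ ≤
              K / k * (‖t‖ ^ D * ‖(truncExp D).eval (1 / (‖t‖ : ℂ))‖)) := by
  obtain ⟨P, hP, hP0, hP1⟩ := exists_qExpansion_discriminant_eq_X_mul
  -- `max C 1` also covers the constant coefficient 1 of `g`, which `C` need not bound.
  obtain ⟨K, hK, hbound⟩ := exists_bound_of_triangular D (max C 1) hP0 hP1
    (fun k' ↦ qExpansion 1 (eisensteinForm k')) faberWeights
    (fun k' hk' ↦ by simpa using coeff_zero_eisensteinForm hk')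
    (qExpansion 1 ModularForm.E₄ ^ 3 * P⁻¹)
  refine ⟨K, hK, fun k ℓ k' hk' hk f ⟨hD, hlow, hlead, hC'⟩ ↦ ?_⟩
  replace hk' : k' ∈ faberWeights := by simpa [faberWeights] using hk'
  -- If `k = 0` then `ℓ = 0`, and the leading 1 would be the constant term of a cusp form.
  have hk1 : 1 ≤ k := by
    by_contra! h0
    have hℓ : ℓ - D = 0 := by omega
    rw [hℓ, CuspFormClass.qExpansion_coeff_zero f one_pos one_mem_strictPeriods_SL] at hlead
    exact zero_ne_one hlead
  have hk0 : 2 * (k : ℂ) ≠ 0 := mul_ne_zero two_ne_zero (by exact_mod_cast (by omega : k ≠ 0))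
  obtain ⟨F, hFdeg, hF⟩ : ∃ F : ℂ[X], F.natDegree ≤ D ∧ IsFaberPolynomial ℓ k' f F :=
    exists_isFaberPolynomial hk' ℓ D hD
      (ModularForm.mcast (by rw [hk]) (CuspForm.toModularFormₗ f)) hlow
  refine ⟨⟨F, hF, fun G hG ↦ hG.unique hk' hF⟩, fun G hG ↦ ?_⟩
  obtain rfl := hG.unique hk' hF
  obtain ⟨g, hg⟩ := PowerSeries.X_pow_dvd_iff.mpr hlow
  have hcoeff (m : ℕ) : PowerSeries.coeff m g = (qExpansion 1 f).coeff (ℓ - D + m) := by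
    rw [hg, add_comm, PowerSeries.coeff_X_pow_mul]
  have hg0 : PowerSeries.constantCoeff g = 1 := by
    rw [← PowerSeries.coeff_zero_eq_constantCoeff_apply, hcoeff, add_zero, hlead]
  have hgC (m : ℕ) (hm : m ≤ D) : ‖PowerSeries.coeff m g‖ ≤ max C 1 := by
    rcases Nat.eq_zero_or_pos m with rfl | hm0
    · simp [hg0]
    · exact hcoeff m ▸ (hC' m hm0 hm).trans (le_max_left _ _)
  have htri (n : ℕ) (hn : n ≤ D) := hG.triangular hk' hD hFdeg hP hP0 hg hn
  -- The equation `n = 0` of the triangular system.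
  have hlc : G.coeff D = 1 := by
    have hE0 : PowerSeries.constantCoeff (qExpansion 1 (eisensteinForm k')) = 1 := by
      simpa using coeff_zero_eisensteinForm hk'
    simpa [hP0, hg0, hE0] using (htri 0 D.zero_le).symm
  have hε := hbound k ℓ k' hk' hk hk1 g hg0 hgC (fun n ↦ G.coeff (D - n)) htri
  refine ⟨hFdeg.antisymm (le_natDegree_of_ne_zero (by simp [hlc])),
    ⟨_, hε, fun t ht ↦ rescaled_eval_eq hFdeg hk0 ht⟩, fun t ht ↦ ?_⟩
  rw [rescaled_eval_eq hFdeg hk0 ht]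
  exact norm_sub_truncExp_le hε t
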